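/- Let $G_\sigma=(G,\sigma)$ be a signed simple graph: $G$ is a finite simple graph with vertices $t_1,\dots,t_s$ and $\sigma\colon E(G)\to\{+,-\}$ assigns a sign to each edge. It is balanced if every cycle of $G$ contains an even number of negative edges, and its frustration index $\varphi(G_\sigma)$ is the smallest number of edges whose deletion leaves a balanced signed graph. Let $K$ be a field with $\operatorname{char}(K)\neq 2$. The incidence matrix of $G_\sigma$ over $K$ has one column for each edge $e=\{t_i,t_j\}$, namely $\mathbf e_i-\mathbf e_j$ if $\sigma(e)=+$ (either order of the endpoints may be chosen) and $\mathbf e_i+\mathbf e_j$ if $\sigma(e)=-$. Let $\mathbb X\subset\mathbb P^{s-1}$ be the set of projective points over $K$ defined by these columns, let $S=K[t_1,\dots,t_s]$ with the standard grading, and let $I(\mathbb X)\subset S$ be the ideal generated by the homogeneous polynomials vanishing at all points of $\mathbb X$. For a proper graded ideal $I\subset S$ with $k=\dim(S/I)$ (Krull dimension) and $H_I(d)=\dim_K(S_d/(I\cap S_d))$, put $\deg(S/I)=(k-1)!\lim_{d\to\infty}H_I(d)/d^{k-1}$ if $k\ge 1$, and $\deg(S/I)=\dim_K(S/I)$ if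 $k=0$. Suppose that $G_\sigma$ is connected and unbalanced (not balanced), and let $\mathcal F$ be the set of linear forms $h=\sum_{i=1}^s a_it_i$ such that $a_i\in\{1,-1\}$ for all $i$ and $(I(\mathbb X)\colon h)\neq I(\mathbb X)$, where $(I(\mathbb X)\colon h)=\{g\in S: gh\in I(\mathbb X)\}$. Then, for every $h\in\mathcal F$, $\deg(S/(I(\mathbb X),h))$ is a well-defined nonnegative integer, the maximum below is attained, and $$\varphi(G_\sigma)=|\mathbb X|-\max\{\deg(S/(I(\mathbb X),h)) : h\in\mathcal F\}.$$ -/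

import Mathlib

open scoped LinearAlgebra.Projectivization

/-- A signed simple graph: a simple graph with a sign `1` or `-1` on each edge. -/
structure SignedSimpleGraph (V : Type*) where
  graph : SimpleGraph V
  sign : graph.edgeSet → ℤˣ

namespace SignedSimpleGraph

/-- Every cycle has an even number of negative edges. -/
def IsBalanced {V : Type*} (G : SignedSimpleGraph V) : Prop :=
  ∀ (v : V) (p : G.graph.Walk v v), p.IsCycle →
    Even {e : G.graph.edgeSet | (e : Sym2 V) ∈ p.edges ∧ G.sign e = -1}.ncard

/-- Deletion of a set of edges; all vertices and the signs of the other edges are kept. -/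
def deleteEdges {V : Type*} (G : SignedSimpleGraph V) (F : Set (Sym2 V)) :
    SignedSimpleGraph V where
  graph := G.graph.deleteEdges F
  sign := fun e => G.sign ⟨e.1, SimpleGraph.edgeSet_mono (G.graph.deleteEdges_le F) e.2⟩

/-- The smallest number of edges whose deletion leaves a balanced signed graph. -/
noncomputable def frustrationIndex {V : Type*} (G : SignedSimpleGraph V) : ℕ :=
  sInf {n | ∃ F : Finset (Sym2 V),
    (F : Set (Sym2 V)) ⊆ G.graph.edgeSet ∧ F.card = n ∧ (G.deleteEdges F).IsBalanced}

/-- `A` is an incidence matrix of `G` over `K`: the column of an edge `e = {i, j}` is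
`e_i - e_j` if `e` is positive and `e_i + e_j` if `e` is negative. The columns of positive edges
are only determined up to sign, since either endpoint may play the role of `i`. -/
def IsIncidenceMatrix {V K : Type*} [DecidableEq V] [Field K] (G : SignedSimpleGraph V)
    (A : Matrix V G.graph.edgeSet K) : Prop :=
  ∀ e : G.graph.edgeSet, ∃ i j : V, (e : Sym2 V) = s(i, j) ∧
    (G.sign e = 1 → A.col e = Pi.single i 1 - Pi.single j 1) ∧
    (G.sign e = -1 → A.col e = Pi.single i 1 + Pi.single j 1)

theorem exists_isIncidenceMatrix {V : Type*} (K : Type*) [DecidableEq V] [Field K]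
    (G : SignedSimpleGraph V) : ∃ A : Matrix V G.graph.edgeSet K, G.IsIncidenceMatrix A := by
  refine ⟨Matrix.of fun v e => if G.sign e = 1
    then (Pi.single (e : Sym2 V).out.1 1 - Pi.single (e : Sym2 V).out.2 1 : V → K) v
    else (Pi.single (e : Sym2 V).out.1 1 + Pi.single (e : Sym2 V).out.2 1 : V → K) v, ?_⟩
  intro e
  refine ⟨(e : Sym2 V).out.1, (e : Sym2 V).out.2, (Quot.out_eq (e : Sym2 V)).symm, ?_, ?_⟩
  · intro h
    funext v
    simp [Matrix.col_apply, h]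
  · intro h
    funext v
    simp [Matrix.col_apply, h]

end SignedSimpleGraph

/-- The set of points of projective space defined by the (nonzero) columns of a matrix. -/
def columnPoints {V E K : Type*} [Field K] (A : Matrix V E K) : Set (ℙ K (V → K)) :=
  {P | ∃ (e : E) (he : A.col e ≠ 0), P = Projectivization.mk K (A.col e) he}

/-- The ideal generated by the homogeneous polynomials that vanish at all points of `X`. -/
noncomputable def projVanishingIdeal {V K : Type*} [Field K] (X : Set (ℙ K (V → K))) :
    Ideal (MvPolynomial V K) :=
  Ideal.span {f | ∃ d : ℕ, f.IsHomogeneous d ∧ ∀ P ∈ X, MvPolynomial.eval P.rep f = 0}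

/-- The Hilbert function `d ↦ dim_K (S_d / I_d)` of `S / I`, where `I_d = I ∩ S_d`. -/
noncomputable def hilbertFun {V K : Type*} [Field K] (I : Ideal (MvPolynomial V K)) (d : ℕ) : ℕ :=
  Module.finrank K (MvPolynomial.homogeneousSubmodule V K d ⧸
    (I.restrictScalars K).submoduleOf (MvPolynomial.homogeneousSubmodule V K d))

/-- `S / I` has degree (multiplicity) `n`. With `k` the Krull dimension of `S / I`, this says
`n = (k - 1)! * lim H_I(d) / d ^ (k - 1)`, and the limit exists, if `k ≥ 1`;
and `n = dim_K (S / I)` if `k = 0`. -/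
def HasDegree {V K : Type*} [Field K] (I : Ideal (MvPolynomial V K)) (n : ℕ) : Prop :=
  (∃ k : ℕ, 1 ≤ k ∧ ringKrullDim (MvPolynomial V K ⧸ I) = k ∧
    Filter.Tendsto
      (fun d : ℕ => ((k - 1).factorial : ℝ) * ((hilbertFun I d : ℝ) / (d : ℝ) ^ (k - 1)))
      Filter.atTop (nhds (n : ℝ))) ∨
  (ringKrullDim (MvPolynomial V K ⧸ I) = 0 ∧ n = Module.finrank K (MvPolynomial V K ⧸ I))

/-- The linear forms `h = ∑ aᵢ tᵢ` with all `aᵢ = ±1` and `(I : h) ≠ I`. -/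
def signForms {V K : Type*} [Fintype V] [Field K] (I : Ideal (MvPolynomial V K)) :
    Set (MvPolynomial V K) :=
  {h | (∃ a : V → K, (∀ i, a i = 1 ∨ a i = -1) ∧
      h = ∑ i, MvPolynomial.C (a i) * MvPolynomial.X i) ∧
    I.colon {h} ≠ I}

/-! ### Switching functions from cycle products -/

namespace SimpleGraph

/-! A signed graph is balanced exactly when its signs have the form `a u * a v` for a switching
function `a : V → ±1`, so the frustration index is the least number of edges violating this rule,
over all `a` (`exists_ncard_frustratedEdges_eq`). The form `∑ a i t_i` takes the value `a i ∓ a j`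
at the column of an edge, and since `2 ≠ 0` this vanishes exactly when the edge obeys the rule.
Distinct edges give distinct points, so the number of zeros of the form in `X` plus the number of
violating edges is `|X|`.

On the algebraic side, for finite `X` and a form `h` with a zero in `X`, the quotient by `(I(X), h)`
has dimension one and its Hilbert function is eventually the number of zeros of `h` in `X`; this
number is the degree (`hasDegree_sup_span_iff`). The colon condition says that such a zero exists
(`colon_ne_iff`). An optimal `a` satisfies at least one edge, so its form is admissible, and
maximizing the degree minimizes the violations. -/

theorem Walk.prod_map_edges_eq_of_potential {V M : Type*} [CommGroup M] {H : SimpleGraph V}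
    {s : Sym2 V → M} {a : V → M} (ha : ∀ v, a v * a v = 1)
    (hs : ∀ e ∈ H.edgeSet, s e = (e.map a).mul) {u v : V} (p : H.Walk u v) :
    (p.edges.map s).prod = a u * a v := by
  induction p with
  | nil => simp [ha]
  | @cons u v w h p ih =>
    rw [Walk.edges_cons, List.map_cons, List.prod_cons, ih, hs s(u, v) h]
    simp only [Sym2.map_mk, Sym2.mul_mk]
    rw [mul_assoc, ← mul_assoc (a v), ha, one_mul]

/-- If the product of the signs along every cycle is `1`, then the signs come from a switching
function on the vertices. -/
theorem exists_potential_of_prod_cycle_eq_one {V : Type*} [Finite V] (s : Sym2 V → ℤˣ)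
    (H : SimpleGraph V)
    (hH : ∀ (v : V) (p : H.Walk v v), p.IsCycle → (p.edges.map s).prod = 1) :
    ∃ a : V → ℤˣ, ∀ e ∈ H.edgeSet, s e = (e.map a).mul := by
  classical
  induction hn : H.edgeSet.ncard using Nat.strong_induction_on generalizing H with
  | _ n ih =>
  by_cases hE : H.edgeSet = ∅
  · exact ⟨1, by simp [hE]⟩
  obtain ⟨e, he⟩ := Set.nonempty_iff_ne_empty.mpr hE
  induction e with
  | _ u v =>
  have hle : H.deleteEdges {s(u, v)} ≤ H := H.deleteEdges_le _
  have hcard : (H.deleteEdges {s(u, v)}).edgeSet.ncard < n := by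
    rw [edgeSet_deleteEdges, ← hn]
    exact Set.ncard_sdiff_singleton_lt_of_mem he (Set.toFinite _)
  obtain ⟨a, ha⟩ := ih _ hcard (H.deleteEdges {s(u, v)}) (fun w p hp => by
    have := hH w (p.mapLe hle) (hp.mapLe hle)
    simpa using this) rfl
  have key : ∀ b : V → ℤˣ, (∀ e ∈ (H.deleteEdges {s(u, v)}).edgeSet, s e = (e.map b).mul) →
      s s(u, v) = b u * b v → ∃ a : V → ℤˣ, ∀ e ∈ H.edgeSet, s e = (e.map a).mul := by
    intro b hb huv
    refine ⟨b, fun e he => ?_⟩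
    by_cases h : e = s(u, v)
    · subst h; simpa using huv
    · exact hb e (by rw [edgeSet_deleteEdges]; exact ⟨he, h⟩)
  -- If `u` and `v` stay connected, a path between them closes up with the deleted edge to a cycle,
  -- which forces the right sign on that edge.
  by_cases hr : (H.deleteEdges {s(u, v)}).Reachable v u
  · obtain ⟨p, hp⟩ := hr.exists_isPath
    refine key a ha ?_
    have hadj : H.Adj u v := he
    have hcyc : (Walk.cons hadj (p.mapLe hle)).IsCycle := by
      rw [Walk.cons_isCycle_iff]
      refine ⟨hp.mapLe hle, fun hmem => ?_⟩
      have : s(u, v) ∈ p.edges := by simpa using hmem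
      have := p.edges_subset_edgeSet this
      simp [edgeSet_deleteEdges] at this
    have h1 := hH u _ hcyc
    have h2 := p.prod_map_edges_eq_of_potential (fun w => Int.units_mul_self _) ha
    rw [Walk.edges_cons, List.map_cons, List.prod_cons] at h1
    have h3 : (p.mapLe hle).edges = p.edges := by simp
    rw [h3, h2] at h1
    rw [eq_inv_of_mul_eq_one_left h1, Int.units_inv_eq_self, mul_comm]
  -- The edge is a bridge: negating `a` on the component of `v` changes only the product across this
  -- edge.
  · by_cases hs : s s(u, v) = a u * a v
    · exact key a ha hs
    · refine key (fun w => if (H.deleteEdges {s(u, v)}).Reachable v w then -a w else a w) ?_ ?_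
      · intro e he
        rw [ha e he]
        induction e with
        | _ x y =>
        have : (H.deleteEdges {s(u, v)}).Reachable v x ↔
            (H.deleteEdges {s(u, v)}).Reachable v y :=
          ⟨fun h => h.trans (Adj.reachable he), fun h => h.trans (Adj.reachable he).symm⟩
        by_cases hx : (H.deleteEdges {s(u, v)}).Reachable v x
        · simp [hx, this.mp hx]
        · simp [hx, mt this.mpr hx]
      · simp only [hr, if_false, Reachable.refl, if_true]
        rw [mul_neg]
        rcases Int.units_eq_one_or (s s(u, v)) with h | h <;>
        rcases Int.units_eq_one_or (a u * a v) with h' | h' <;> simp_all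

end SimpleGraph

/-! ### Frustration index as a minimum over switching functions -/

namespace SignedSimpleGraph

variable {V : Type*} (G : SignedSimpleGraph V)

open Classical in
/-- The sign function, extended by `1` to all pairs of vertices. -/
noncomputable def extendedSign (e : Sym2 V) : ℤˣ :=
  if h : e ∈ G.graph.edgeSet then G.sign ⟨e, h⟩ else 1

theorem extendedSign_of_mem {e : Sym2 V} (h : e ∈ G.graph.edgeSet) :
    G.extendedSign e = G.sign ⟨e, h⟩ := dif_pos h

theorem extendedSign_deleteEdges (F : Set (Sym2 V)) {e : Sym2 V}
    (h : e ∈ (G.deleteEdges F).graph.edgeSet) :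
    (G.deleteEdges F).extendedSign e = G.extendedSign e := by
  have h' : e ∈ G.graph.edgeSet := SimpleGraph.edgeSet_mono (G.graph.deleteEdges_le F) h
  rw [extendedSign_of_mem _ h, extendedSign_of_mem _ h']
  rfl

theorem _root_.List.prod_map_units_int_eq {α : Type*} (s : α → ℤˣ) (l : List α) :
    (l.map s).prod = (-1) ^ (l.filter (s · = -1)).length := by
  induction l with
  | nil => simp
  | cons x l ih =>
    rcases Int.units_eq_one_or (s x) with h | h
    · simp [h, ih]
    · simp [h, ih, pow_succ]

theorem even_ncard_negative_iff {l : List (Sym2 V)} (hl : l.Nodup)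
    (hE : ∀ e ∈ l, e ∈ G.graph.edgeSet) :
    Even {e : G.graph.edgeSet | (e : Sym2 V) ∈ l ∧ G.sign e = -1}.ncard ↔
      (l.map G.extendedSign).prod = 1 := by
  classical
  have hset : Subtype.val '' {e : G.graph.edgeSet | (e : Sym2 V) ∈ l ∧ G.sign e = -1} =
      ((l.filter (G.extendedSign · = -1)).toFinset : Set (Sym2 V)) := by
    ext e
    simp only [Set.mem_image, Set.mem_ofPred_eq, Subtype.exists, exists_and_right, exists_eq_right,
      List.coe_toFinset, List.mem_filter, decide_eq_true_eq]
    constructor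
    · rintro ⟨he, hel, hs⟩
      exact ⟨hel, by rw [G.extendedSign_of_mem he, hs]⟩
    · rintro ⟨hel, hs⟩
      exact ⟨hE e hel, hel, by rw [← G.extendedSign_of_mem, hs]⟩
  rw [← Set.ncard_image_of_injective _ Subtype.val_injective, hset, Set.ncard_coe_finset,
    List.toFinset_card_of_nodup (hl.filter _), List.prod_map_units_int_eq]
  exact (neg_one_pow_eq_one_iff_even (by decide)).symm

theorem isBalanced_iff_prod_eq_one :
    G.IsBalanced ↔ ∀ (v : V) (p : G.graph.Walk v v), p.IsCycle →
      (p.edges.map G.extendedSign).prod = 1 := by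
  refine forall_congr' fun v => forall_congr' fun p => imp_congr_right fun hp => ?_
  exact G.even_ncard_negative_iff hp.isCircuit.isTrail.edges_nodup
    (fun e he => p.edges_subset_edgeSet he)

/-- The edges whose sign is not the one induced by the switching function `a`. -/
def frustratedEdges (a : V → ℤˣ) : Set (Sym2 V) :=
  {e ∈ G.graph.edgeSet | G.extendedSign e ≠ (e.map a).mul}

theorem isBalanced_deleteEdges_frustratedEdges (a : V → ℤˣ) :
    (G.deleteEdges (G.frustratedEdges a)).IsBalanced := by
  rw [isBalanced_iff_prod_eq_one]
  intro v p _
  have := p.prod_map_edges_eq_of_potential (s := (G.deleteEdges (G.frustratedEdges a)).extendedSign)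
    (a := a) (fun w => Int.units_mul_self _) (fun e he => by
      rw [extendedSign_deleteEdges _ _ he]
      have he' : e ∈ G.graph.edgeSet \ G.frustratedEdges a := by
        rw [← SimpleGraph.edgeSet_deleteEdges]; exact he
      by_contra hne
      exact he'.2 ⟨he'.1, hne⟩)
  rw [this, Int.units_mul_self]

/-- A switching function for the balanced remainder can be violated only on deleted edges. Minimal
deletions may therefore be sought among the sets `frustratedEdges a`. -/
theorem exists_frustratedEdges_subset [Finite V] {F : Set (Sym2 V)}
    (hF : (G.deleteEdges F).IsBalanced) : ∃ a : V → ℤˣ, G.frustratedEdges a ⊆ F := by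
  rw [isBalanced_iff_prod_eq_one] at hF
  obtain ⟨a, ha⟩ := SimpleGraph.exists_potential_of_prod_cycle_eq_one _ _ hF
  refine ⟨a, fun e he => ?_⟩
  by_contra hne
  have he' : e ∈ (G.deleteEdges F).graph.edgeSet := by
    change e ∈ (G.graph.deleteEdges F).edgeSet
    rw [SimpleGraph.edgeSet_deleteEdges]
    exact ⟨he.1, hne⟩
  exact he.2 (by rw [← ha e he', extendedSign_deleteEdges _ _ he'])

theorem frustrationIndex_le [Finite V] (a : V → ℤˣ) :
    G.frustrationIndex ≤ (G.frustratedEdges a).ncard := by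
  have hfin : (G.frustratedEdges a).Finite := Set.toFinite _
  refine Nat.sInf_le ⟨hfin.toFinset, ?_, (Set.ncard_eq_toFinset_card _ hfin).symm, ?_⟩
  · rw [hfin.coe_toFinset]
    exact fun e he => he.1
  · rw [hfin.coe_toFinset]
    exact G.isBalanced_deleteEdges_frustratedEdges a

theorem exists_ncard_frustratedEdges_eq [Finite V] :
    ∃ a : V → ℤˣ, (G.frustratedEdges a).ncard = G.frustrationIndex := by
  -- Needed because `sInf` of an empty set of naturals is the default `0`.
  have hne : {n | ∃ F : Finset (Sym2 V), (F : Set (Sym2 V)) ⊆ G.graph.edgeSet ∧ F.card = n ∧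
      (G.deleteEdges F).IsBalanced}.Nonempty := by
    have hfin : (G.frustratedEdges 1).Finite := Set.toFinite _
    refine ⟨_, hfin.toFinset, ?_, rfl, ?_⟩
    · rw [hfin.coe_toFinset]
      exact fun e he => he.1
    · rw [hfin.coe_toFinset]
      exact G.isBalanced_deleteEdges_frustratedEdges 1
  obtain ⟨F, -, hcard, hbal⟩ := Nat.sInf_mem hne
  obtain ⟨a, ha⟩ := G.exists_frustratedEdges_subset hbal
  refine ⟨a, le_antisymm ?_ (G.frustrationIndex_le a)⟩
  calc (G.frustratedEdges a).ncard ≤ (F : Set (Sym2 V)).ncard :=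
        Set.ncard_le_ncard ha (Set.toFinite _)
    _ = G.frustrationIndex := by rw [Set.ncard_coe_finset, hcard]; rfl

end SignedSimpleGraph

/-! ### Vanishing ideals of finite point sets and their degrees -/

section PointIdeal

variable {V K : Type*} [Field K]

/-- The restriction of polynomials to the line spanned by `x`. -/
noncomputable def lineRestriction (x : V → K) : MvPolynomial V K →ₐ[K] Polynomial K :=
  MvPolynomial.aeval fun i => Polynomial.C (x i) * Polynomial.X

theorem lineRestriction_surjective {x : V → K} (hx : x ≠ 0) :
    Function.Surjective (lineRestriction x) := by
  obtain ⟨i, hi⟩ := Function.ne_iff.mp hx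
  rw [← AlgHom.range_eq_top, eq_top_iff, ← Polynomial.adjoin_X, Algebra.adjoin_le_iff,
    Set.singleton_subset_iff]
  refine ⟨MvPolynomial.C (x i)⁻¹ * MvPolynomial.X i, ?_⟩
  change lineRestriction x _ = _
  rw [lineRestriction, map_mul, MvPolynomial.aeval_X, MvPolynomial.aeval_C,
    Polynomial.algebraMap_eq, ← mul_assoc, ← map_mul, inv_mul_cancel₀ hi, map_one, one_mul]

/-- Modulo the kernel the ring becomes `K[X]`, where nonzero primes are maximal. -/
theorem isMaximal_of_ker_lineRestriction_lt {x : V → K} (hx : x ≠ 0)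
    {q : Ideal (MvPolynomial V K)} (hq : q.IsPrime)
    (hlt : RingHom.ker (lineRestriction x) < q) : q.IsMaximal := by
  have hs := lineRestriction_surjective hx
  have hcomap : (q.map (lineRestriction x)).comap (lineRestriction x) = q := by
    rw [Ideal.comap_map_of_surjective' _ hs, sup_eq_left]
    exact hlt.le
  have := Ideal.map_isPrime_of_surjective hs hlt.le
  have hne : q.map (lineRestriction x) ≠ ⊥ := by
    intro h0
    rw [h0] at hcomap
    exact hlt.ne hcomap
  have : (q.map (lineRestriction x)).IsMaximal := this.isMaximal hne
  rw [← hcomap]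
  exact Ideal.comap_isMaximal_of_surjective _ hs

theorem eval_eq_zero_of_mem_projVanishingIdeal {X : Set (ℙ K (V → K))} {f : MvPolynomial V K}
    (hf : f ∈ projVanishingIdeal X) {P : ℙ K (V → K)} (hP : P ∈ X) :
    MvPolynomial.eval P.rep f = 0 := by
  have hle : projVanishingIdeal X ≤ RingHom.ker (MvPolynomial.eval P.rep) := by
    refine Ideal.span_le.mpr ?_
    rintro g ⟨d, hg, hgX⟩
    exact hgX P hP
  exact hle hf

/-- Some 2×2 minor of the two representatives is nonzero, for otherwise they would be proportional;
the separator is that minor with the entries of `P` replaced by variables. -/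
theorem exists_linear_separator {P Q : ℙ K (V → K)} (hPQ : P ≠ Q) :
    ∃ f : MvPolynomial V K, f.IsHomogeneous 1 ∧ MvPolynomial.eval P.rep f ≠ 0 ∧
      MvPolynomial.eval Q.rep f = 0 := by
  have hex : ∃ i j, Q.rep j * P.rep i - Q.rep i * P.rep j ≠ 0 := by
    by_contra! hall
    obtain ⟨k, hk⟩ := Function.ne_iff.mp Q.rep_nonzero
    rw [Pi.zero_apply] at hk
    apply hPQ
    rw [← P.mk_rep, ← Q.mk_rep, Projectivization.mk_eq_mk_iff']
    refine ⟨P.rep k / Q.rep k, funext fun i => ?_⟩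
    have := hall i k
    rw [Pi.smul_apply, smul_eq_mul]
    field_simp
    linear_combination -this
  obtain ⟨i, j, hij⟩ := hex
  refine ⟨MvPolynomial.C (Q.rep j) * MvPolynomial.X i - MvPolynomial.C (Q.rep i) * MvPolynomial.X j,
    ?_, by simpa using hij, by simp [mul_comm]⟩
  exact ((MvPolynomial.isHomogeneous_X K i).C_mul _).sub ((MvPolynomial.isHomogeneous_X K j).C_mul _)

/-- One linear factor for each point of `X`, padded to degree `d` by a coordinate not vanishing at
`P`, then normalized at `P`. -/
theorem exists_separator {X : Set (ℙ K (V → K))} (hX : X.Finite) {P : ℙ K (V → K)} (d : ℕ)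
    (hd : X.ncard ≤ d) :
    ∃ f : MvPolynomial V K, f.IsHomogeneous d ∧ MvPolynomial.eval P.rep f = 1 ∧
      ∀ Q ∈ X, Q ≠ P → MvPolynomial.eval Q.rep f = 0 := by
  classical
  obtain ⟨i, hi⟩ := Function.ne_iff.mp P.rep_nonzero
  rw [Pi.zero_apply] at hi
  have hsep : ∀ Q : ℙ K (V → K), ∃ f : MvPolynomial V K, f.IsHomogeneous 1 ∧
      MvPolynomial.eval P.rep f ≠ 0 ∧ (Q ≠ P → MvPolynomial.eval Q.rep f = 0) := by
    intro Q
    by_cases hQ : Q = P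
    · exact ⟨MvPolynomial.X i, MvPolynomial.isHomogeneous_X K i, by simpa using hi,
        fun h => absurd hQ h⟩
    · obtain ⟨f, h1, h2, h3⟩ := exists_linear_separator (Ne.symm hQ)
      exact ⟨f, h1, h2, fun _ => h3⟩
  choose ℓ hℓ1 hℓ2 hℓ3 using hsep
  set g : MvPolynomial V K :=
    (∏ Q ∈ hX.toFinset, ℓ Q) * MvPolynomial.X i ^ (d - X.ncard) with hg
  have hgP : MvPolynomial.eval P.rep g ≠ 0 := by
    rw [hg, map_mul, map_prod, map_pow, MvPolynomial.eval_X]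
    exact mul_ne_zero (Finset.prod_ne_zero_iff.mpr fun Q _ => hℓ2 Q) (pow_ne_zero _ hi)
  have hghom : g.IsHomogeneous d := by
    have h1 := MvPolynomial.IsHomogeneous.prod hX.toFinset ℓ (fun _ => 1) fun Q _ => hℓ1 Q
    have h2 := h1.mul ((MvPolynomial.isHomogeneous_X K i).pow (d - X.ncard))
    convert h2 using 1
    rw [Finset.sum_const, smul_eq_mul, mul_one, one_mul, ← Set.ncard_eq_toFinset_card _ hX]
    omega
  refine ⟨MvPolynomial.C (MvPolynomial.eval P.rep g)⁻¹ * g, hghom.C_mul _, ?_, fun Q hQ hQP => ?_⟩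
  · rw [map_mul, MvPolynomial.eval_C, inv_mul_cancel₀ hgP]
  · have hgQ : MvPolynomial.eval Q.rep g = 0 := by
      rw [hg, map_mul, map_prod,
        Finset.prod_eq_zero (hX.mem_toFinset.mpr hQ) (hℓ3 Q hQP), zero_mul]
    rw [map_mul, hgQ, mul_zero]

/-- In large degrees, the forms in `(I(X), h)` are those that vanish at the zeros of `h` in `X`. -/
theorem mem_sup_span_iff {X : Set (ℙ K (V → K))} (hX : X.Finite) {h : MvPolynomial V K} {c : ℕ}
    (hh : h.IsHomogeneous c) {d : ℕ} (hd : X.ncard + c ≤ d) {f : MvPolynomial V K}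
    (hf : f.IsHomogeneous d) :
    f ∈ projVanishingIdeal X ⊔ Ideal.span {h} ↔
      ∀ P ∈ X, MvPolynomial.eval P.rep h = 0 → MvPolynomial.eval P.rep f = 0 := by
  classical
  constructor
  · intro hmem P hP hP0
    have hle : projVanishingIdeal X ⊔ Ideal.span {h} ≤ RingHom.ker (MvPolynomial.eval P.rep) := by
      refine sup_le (fun g hg => eval_eq_zero_of_mem_projVanishingIdeal hg hP) ?_
      rw [Ideal.span_singleton_le_iff_mem]
      exact hP0
    exact hle hmem
  · intro hvan
    have hsep : ∀ P : ℙ K (V → K), ∃ g : MvPolynomial V K, g.IsHomogeneous (d - c) ∧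
        MvPolynomial.eval P.rep g = 1 ∧ ∀ Q ∈ X, Q ≠ P → MvPolynomial.eval Q.rep g = 0 :=
      fun P => exists_separator hX (d - c) (by omega)
    choose g hg1 hg2 hg3 using hsep
    -- `q` interpolates `f / h` on `X`, so `f - q * h` vanishes there. At zeros of `h` the quotient
    -- is the default `0`, harmless because `f` vanishes too.
    set q : MvPolynomial V K := ∑ P ∈ hX.toFinset,
      MvPolynomial.C (MvPolynomial.eval P.rep f / MvPolynomial.eval P.rep h) * g P with hq
    have hqhom : q.IsHomogeneous (d - c) :=
      MvPolynomial.IsHomogeneous.sum _ _ _ fun P _ => (hg1 P).C_mul _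
    have hqeval : ∀ P ∈ X, MvPolynomial.eval P.rep q =
        MvPolynomial.eval P.rep f / MvPolynomial.eval P.rep h := by
      intro P hP
      rw [hq, map_sum, Finset.sum_eq_single P]
      · rw [map_mul, MvPolynomial.eval_C, hg2, mul_one]
      · intro Q _ hQP
        rw [map_mul, hg3 Q P hP hQP.symm, mul_zero]
      · intro hnot
        exact absurd (hX.mem_toFinset.mpr hP) hnot
    have hdiff : f - q * h ∈ projVanishingIdeal X := by
      refine Ideal.subset_span ⟨d, hf.sub ?_, fun P hP => ?_⟩
      · have := hqhom.mul hh
        rwa [Nat.sub_add_cancel (by omega)] at this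
      · rw [map_sub, map_mul, hqeval P hP]
        by_cases hP0 : MvPolynomial.eval P.rep h = 0
        · rw [hP0, hvan P hP hP0]; simp
        · rw [div_mul_cancel₀ _ hP0, sub_self]
    rw [← sub_add_cancel f (q * h)]
    exact Ideal.add_mem _ (Ideal.mem_sup_left hdiff)
      (Ideal.mem_sup_right (Ideal.mul_mem_left _ _ (Ideal.mem_span_singleton_self h)))

/-- Evaluation at the zeros of `h` in `X` has the degree-`d` part of the ideal as kernel, by
`mem_sup_span_iff`, and is onto by separators. -/
theorem hilbertFun_sup_span {X : Set (ℙ K (V → K))} (hX : X.Finite) {h : MvPolynomial V K} {c : ℕ}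
    (hh : h.IsHomogeneous c) {d : ℕ} (hd : X.ncard + c ≤ d) :
    hilbertFun (projVanishingIdeal X ⊔ Ideal.span {h}) d =
      {P ∈ X | MvPolynomial.eval P.rep h = 0}.ncard := by
  classical
  set Y : Set (ℙ K (V → K)) := {P ∈ X | MvPolynomial.eval P.rep h = 0} with hY
  have hYfin : Y.Finite := hX.subset fun P hP => hP.1
  have : Fintype Y := hYfin.fintype
  let ev : MvPolynomial.homogeneousSubmodule V K d →ₗ[K] (Y → K) :=
    LinearMap.pi fun P => (MvPolynomial.aeval (R := K) P.1.rep).toLinearMap ∘ₗ Submodule.subtype _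
  have hev : ∀ f P, ev f P = MvPolynomial.eval P.1.rep f.1 := fun f P => by
    simp [ev, MvPolynomial.aeval_eq_eval]
  have hker : ((projVanishingIdeal X ⊔ Ideal.span {h}).restrictScalars K).submoduleOf
      (MvPolynomial.homogeneousSubmodule V K d) = LinearMap.ker ev := by
    ext f
    rw [LinearMap.mem_ker]
    refine (mem_sup_span_iff hX hh hd f.2).trans ⟨fun hf => ?_, fun hf P hP hP0 => ?_⟩
    · funext P
      rw [hev]
      exact hf P.1 P.2.1 P.2.2
    · rw [← hev f ⟨P, hP, hP0⟩, hf, Pi.zero_apply]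
  have hsurj : Function.Surjective ev := by
    intro w
    have hsep : ∀ P : Y, ∃ g : MvPolynomial V K, g.IsHomogeneous d ∧
        MvPolynomial.eval P.1.rep g = 1 ∧ ∀ Q ∈ X, Q ≠ P.1 → MvPolynomial.eval Q.rep g = 0 :=
      fun P => exists_separator hX d (by omega)
    choose g hg1 hg2 hg3 using hsep
    refine ⟨⟨∑ P, MvPolynomial.C (w P) * g P,
      MvPolynomial.IsHomogeneous.sum _ _ _ fun P _ => (hg1 P).C_mul _⟩, ?_⟩
    funext P
    rw [hev, map_sum, Finset.sum_eq_single P]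
    · rw [map_mul, MvPolynomial.eval_C, hg2, mul_one]
    · intro Q _ hQP
      rw [map_mul, hg3 Q P P.2.1 (fun heq => hQP (Subtype.ext heq.symm)), mul_zero]
    · exact fun hnot => absurd (Finset.mem_univ _) hnot
  rw [hilbertFun, hker, (LinearMap.quotKerEquivOfSurjective ev hsurj).finrank_eq,
    Module.finrank_fintype_fun_eq_card, ← Nat.card_eq_fintype_card, Nat.card_coe_set_eq]

variable [Fintype V]

theorem lineRestriction_of_isHomogeneous (x : V → K) {f : MvPolynomial V K} {d : ℕ}
    (hf : f.IsHomogeneous d) :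
    lineRestriction x f = Polynomial.C (MvPolynomial.eval x f) * Polynomial.X ^ d := by
  rw [lineRestriction, MvPolynomial.aeval_def, MvPolynomial.eval₂_eq', MvPolynomial.eval_eq',
    map_sum, Finset.sum_mul]
  refine Finset.sum_congr rfl fun m hm => ?_
  have hdeg : ∑ i, m i = d := by
    rw [← Finsupp.degree_eq_sum]
    by_contra hne
    exact (MvPolynomial.mem_support_iff.mp hm) (hf.coeff_eq_zero hne)
  simp only [mul_pow, Finset.prod_mul_distrib, Finset.prod_pow_eq_pow_sum, hdeg, map_mul, map_prod,
    map_pow, Polynomial.algebraMap_eq, mul_assoc]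

theorem coeff_lineRestriction (x : V → K) (f : MvPolynomial V K) (d : ℕ) :
    (lineRestriction x f).coeff d =
      MvPolynomial.eval x (MvPolynomial.homogeneousComponent d f) := by
  conv_lhs => rw [← MvPolynomial.sum_homogeneousComponent f]
  rw [map_sum, Polynomial.finsetSum_coeff]
  simp only [lineRestriction_of_isHomogeneous x (MvPolynomial.homogeneousComponent_isHomogeneous _ f),
    Polynomial.coeff_C_mul_X_pow]
  rw [Finset.sum_ite_eq]
  split_ifs with h
  · rfl
  · rw [MvPolynomial.homogeneousComponent_eq_zero _ _ (by simpa using h), map_zero]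

/-- The formal restriction to a line records the value of each homogeneous component as a
coefficient. This describes inhomogeneous members too, even over finite fields, and exhibits the
ideal as an intersection of primes. -/
theorem mem_projVanishingIdeal_iff {X : Set (ℙ K (V → K))} {f : MvPolynomial V K} :
    f ∈ projVanishingIdeal X ↔ ∀ P ∈ X, lineRestriction P.rep f = 0 := by
  constructor
  · intro hf P hP
    have hle : projVanishingIdeal X ≤ RingHom.ker (lineRestriction P.rep) := by
      refine Ideal.span_le.mpr ?_
      rintro g ⟨d, hg, hgX⟩
      change lineRestriction P.rep g = 0
      rw [lineRestriction_of_isHomogeneous _ hg, hgX P hP, map_zero, zero_mul]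
    exact hle hf
  · intro h
    rw [← MvPolynomial.sum_homogeneousComponent f]
    refine Ideal.sum_mem _ fun d _ => Ideal.subset_span
      ⟨d, MvPolynomial.homogeneousComponent_isHomogeneous _ _, fun P hP => ?_⟩
    rw [← coeff_lineRestriction, h P hP, Polynomial.coeff_zero]

/-- Off the zeros of `h`, one can cancel `h` on each line. If `h` vanishes at `P`, a separator of
`P` lies in the colon ideal but not in the vanishing ideal. -/
theorem colon_ne_iff {X : Set (ℙ K (V → K))} (hX : X.Finite) {h : MvPolynomial V K} {c : ℕ}
    (hh : h.IsHomogeneous c) :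
    (projVanishingIdeal X).colon {h} ≠ projVanishingIdeal X ↔
      {P ∈ X | MvPolynomial.eval P.rep h = 0}.Nonempty := by
  constructor
  · contrapose!
    intro hne
    refine le_antisymm (fun g hg => ?_) fun g hg => ?_
    · rw [Submodule.mem_colon_singleton, smul_eq_mul, mem_projVanishingIdeal_iff] at hg
      refine mem_projVanishingIdeal_iff.mpr fun P hP => ?_
      have hP0 : MvPolynomial.eval P.rep h ≠ 0 := fun h0 =>
        (Set.eq_empty_iff_forall_notMem.mp hne P) ⟨hP, h0⟩
      have := hg P hP
      rw [map_mul, lineRestriction_of_isHomogeneous _ hh] at this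
      refine (mul_eq_zero.mp this).resolve_right ?_
      exact mul_ne_zero (Polynomial.C_ne_zero.mpr hP0) (pow_ne_zero _ Polynomial.X_ne_zero)
    · rw [Submodule.mem_colon_singleton, smul_eq_mul]
      exact Ideal.mul_mem_right _ _ hg
  · rintro ⟨P, hP, hP0⟩ heq
    obtain ⟨f, hf, hfP, hfQ⟩ := exists_separator hX (P := P) X.ncard le_rfl
    have hmem : f ∈ (projVanishingIdeal X).colon {h} := by
      rw [Submodule.mem_colon_singleton, smul_eq_mul]
      refine Ideal.subset_span ⟨_, hf.mul hh, fun Q hQ => ?_⟩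
      rw [map_mul]
      by_cases hQP : Q = P
      · rw [hQP, hP0, mul_zero]
      · rw [hfQ Q hQ hQP, zero_mul]
    rw [heq] at hmem
    exact one_ne_zero (hfP.symm.trans (eval_eq_zero_of_mem_projVanishingIdeal hmem hP))

/-- A prime over `J` contains the kernel of one of the finitely many line restrictions, hence equals
it or is maximal. Conversely, the quotient surjects onto `K[X]`. -/
theorem ringKrullDim_quotient_eq_one {X : Set (ℙ K (V → K))} (hX : X.Finite)
    {J : Ideal (MvPolynomial V K)} (hJ : projVanishingIdeal X ≤ J) {P : ℙ K (V → K)}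
    (hP : J ≤ RingHom.ker (lineRestriction P.rep)) :
    ringKrullDim (MvPolynomial V K ⧸ J) = 1 := by
  refine le_antisymm ?_ ?_
  · have hpt : ∀ q : Ideal (MvPolynomial V K), q.IsPrime → J ≤ q →
        ∃ Q ∈ X, RingHom.ker (lineRestriction Q.rep) ≤ q := by
      intro q hq hJq
      have hinf : hX.toFinset.inf (fun Q => RingHom.ker (lineRestriction Q.rep)) ≤ q := by
        refine le_trans (fun f hf => ?_) (hJ.trans hJq)
        refine mem_projVanishingIdeal_iff.mpr fun Q hQ => ?_
        exact Finset.inf_le (f := fun Q : ℙ K (V → K) => RingHom.ker (lineRestriction Q.rep))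
          (hX.mem_toFinset.mpr hQ) hf
      obtain ⟨Q, hQ, hle⟩ := hq.inf_le'.mp hinf
      exact ⟨Q, hX.mem_toFinset.mp hQ, hle⟩
    have hsurj : Function.Surjective (Ideal.Quotient.mk J) := Ideal.Quotient.mk_surjective
    have hle : ∀ q : Ideal (MvPolynomial V K ⧸ J), J ≤ q.comap (Ideal.Quotient.mk J) := by
      intro q f hf
      rw [Ideal.mem_comap, Ideal.Quotient.eq_zero_iff_mem.mpr hf]
      exact q.zero_mem
    have h1 : Ring.KrullDimLE 1 (MvPolynomial V K ⧸ J) := by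
      rw [Ring.krullDimLE_one_iff]
      intro q hq
      by_cases hmax : (q.comap (Ideal.Quotient.mk J)).IsMaximal
      · right
        have := Ideal.map_eq_top_or_isMaximal_of_surjective _ hsurj hmax
        rw [Ideal.map_comap_of_surjective _ hsurj] at this
        exact this.resolve_left hq.ne_top
      · left
        refine ⟨⟨hq, bot_le⟩, fun p hp hpq => ?_⟩
        have hpp : (p.comap (Ideal.Quotient.mk J)).IsPrime := hp.1.comap _
        have hqp : (q.comap (Ideal.Quotient.mk J)).IsPrime := hq.comap _
        obtain ⟨Q, -, hQ⟩ := hpt _ hpp (hle p)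
        have hpq' : p.comap (Ideal.Quotient.mk J) ≤ q.comap (Ideal.Quotient.mk J) :=
          Ideal.comap_mono hpq
        have heq : RingHom.ker (lineRestriction Q.rep) = q.comap (Ideal.Quotient.mk J) := by
          by_contra hne
          exact hmax (isMaximal_of_ker_lineRestriction_lt Q.rep_nonzero hqp
            (lt_of_le_of_ne (hQ.trans hpq') hne))
        have := Ideal.map_mono (f := Ideal.Quotient.mk J) (heq ▸ hQ)
        rwa [Ideal.map_comap_of_surjective _ hsurj, Ideal.map_comap_of_surjective _ hsurj] at this
    exact_mod_cast Ring.krullDimLE_iff.mp h1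
  · rw [← IsPrincipalIdealRing.ringKrullDim_eq_one (Polynomial K) (Polynomial.not_isField K)]
    refine ringKrullDim_le_of_surjective
      (Ideal.Quotient.lift J (lineRestriction P.rep : MvPolynomial V K →+* Polynomial K)
        fun f hf => hP hf) ?_
    exact Ideal.Quotient.lift_surjective_of_surjective _ _
      (lineRestriction_surjective P.rep_nonzero)

theorem hasDegree_sup_span_iff {X : Set (ℙ K (V → K))} (hX : X.Finite) {h : MvPolynomial V K}
    {c : ℕ} (hh : h.IsHomogeneous c)
    (hne : {P ∈ X | MvPolynomial.eval P.rep h = 0}.Nonempty) (n : ℕ) :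
    HasDegree (projVanishingIdeal X ⊔ Ideal.span {h}) n ↔
      n = {P ∈ X | MvPolynomial.eval P.rep h = 0}.ncard := by
  obtain ⟨P, hP, hP0⟩ := hne
  have hdim : ringKrullDim (MvPolynomial V K ⧸ (projVanishingIdeal X ⊔ Ideal.span {h})) = 1 := by
    refine ringKrullDim_quotient_eq_one hX le_sup_left (P := P) (sup_le ?_ ?_)
    · exact fun f hf => mem_projVanishingIdeal_iff.mp hf P hP
    · rw [Ideal.span_singleton_le_iff_mem]
      change lineRestriction P.rep h = 0
      rw [lineRestriction_of_isHomogeneous _ hh, hP0, map_zero, zero_mul]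
  -- For `k = 1` the normalizing factors are all `1` and the sequence is eventually constant.
  have hlim : Filter.Tendsto
      (fun d : ℕ => (((1 - 1).factorial : ℕ) : ℝ) *
        ((hilbertFun (projVanishingIdeal X ⊔ Ideal.span {h}) d : ℝ) / (d : ℝ) ^ (1 - 1)))
      Filter.atTop (nhds ({P ∈ X | MvPolynomial.eval P.rep h = 0}.ncard : ℝ)) := by
    refine tendsto_const_nhds.congr' ?_
    filter_upwards [Filter.eventually_ge_atTop (X.ncard + c)] with d hd
    rw [hilbertFun_sup_span hX hh hd]
    simp
  constructor
  · rintro (⟨k, -, hk, hklim⟩ | ⟨h0, -⟩)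
    · rw [hdim] at hk
      obtain rfl : k = 1 := by exact_mod_cast hk.symm
      exact_mod_cast tendsto_nhds_unique hklim hlim
    · rw [hdim] at h0
      exact absurd h0 one_ne_zero
  · rintro rfl
    exact Or.inl ⟨1, le_rfl, by simpa using hdim, hlim⟩

end PointIdeal

/-! ### Sign forms evaluated at the columns -/

namespace SignedSimpleGraph

/-- The linear form whose coefficients are the values of a switching function. -/
noncomputable def switchingForm {V : Type*} [Fintype V] (K : Type*) [Field K]
    (b : V → ℤˣ) : MvPolynomial V K :=
  ∑ i, MvPolynomial.C (((b i : ℤˣ) : ℤ) : K) * MvPolynomial.X i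

theorem switchingForm_isHomogeneous {V K : Type*} [Fintype V] [Field K] (b : V → ℤˣ) :
    (switchingForm K b).IsHomogeneous 1 :=
  MvPolynomial.IsHomogeneous.sum _ _ _ fun i _ => (MvPolynomial.isHomogeneous_X K i).C_mul _

section Columns

variable {V K : Type*} [DecidableEq V] [Field K] {G : SignedSimpleGraph V}
  {A : Matrix V G.graph.edgeSet K}

theorem IsIncidenceMatrix.col_apply_ne_zero_iff (hA : G.IsIncidenceMatrix A)
    (e : G.graph.edgeSet) (v : V) : A.col e v ≠ 0 ↔ v ∈ (e : Sym2 V) := by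
  obtain ⟨i, j, hij, h1, h2⟩ := hA e
  have hne : i ≠ j := by
    have := e.2
    rw [hij, SimpleGraph.mem_edgeSet] at this
    exact this.ne
  rw [hij, Sym2.mem_iff]
  rcases Int.units_eq_one_or (G.sign e) with h | h
  · rw [h1 h]
    by_cases hi : v = i
    · subst hi; simp [hne]
    · by_cases hj : v = j
      · subst hj; simp [hi]
      · simp [hi, hj]
  · rw [h2 h]
    by_cases hi : v = i
    · subst hi; simp [hne]
    · by_cases hj : v = j
      · subst hj; simp [hi]
      · simp [hi, hj]

theorem IsIncidenceMatrix.col_ne_zero (hA : G.IsIncidenceMatrix A) (e : G.graph.edgeSet) :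
    A.col e ≠ 0 := by
  obtain ⟨i, j, hij, -⟩ := hA e
  intro h0
  exact (hA.col_apply_ne_zero_iff e i).mpr (by rw [hij]; exact Sym2.mem_mk_left i j)
    (by rw [h0, Pi.zero_apply])

/-- The projective point defined by the column of an edge. -/
def IsIncidenceMatrix.point (hA : G.IsIncidenceMatrix A) (e : G.graph.edgeSet) : ℙ K (V → K) :=
  Projectivization.mk K (A.col e) (hA.col_ne_zero e)

theorem IsIncidenceMatrix.range_point (hA : G.IsIncidenceMatrix A) :
    Set.range hA.point = columnPoints A := by
  ext P
  constructor
  · rintro ⟨e, rfl⟩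
    exact ⟨e, hA.col_ne_zero e, rfl⟩
  · rintro ⟨e, he, rfl⟩
    exact ⟨e, rfl⟩

/-- Proportional columns have the same support, and the support of a column is its edge. -/
theorem IsIncidenceMatrix.point_injective (hA : G.IsIncidenceMatrix A) :
    Function.Injective hA.point := by
  intro e e' h
  obtain ⟨c, hc⟩ := (Projectivization.mk_eq_mk_iff K _ _ _ _).mp h
  refine Subtype.ext (Sym2.ext fun v => ?_)
  rw [← hA.col_apply_ne_zero_iff, ← hA.col_apply_ne_zero_iff, ← hc, Pi.smul_apply, ne_eq, ne_eq,
    smul_eq_zero_iff_eq]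

variable [Fintype V]

theorem IsIncidenceMatrix.eval_switchingForm_eq_zero_iff (hA : G.IsIncidenceMatrix A)
    (hK : ringChar K ≠ 2) (b : V → ℤˣ) (e : G.graph.edgeSet) :
    MvPolynomial.eval (hA.point e).rep (switchingForm K b) = 0 ↔
      (e : Sym2 V) ∉ G.frustratedEdges b := by
  -- The chosen representative is a unit multiple of the column, so the vanishing can be tested on
  -- the column itself; there the value is `0` or `±2`.
  obtain ⟨c, hc⟩ := Projectivization.exists_smul_eq_mk_rep K (A.col e) (hA.col_ne_zero e)
  have h2 : (2 : K) ≠ 0 := Ring.two_ne_zero hK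
  have hsum : MvPolynomial.eval (hA.point e).rep (switchingForm K b) =
      (c : K) * ∑ i, (((b i : ℤˣ) : ℤ) : K) * A.col e i := by
    rw [point, ← hc, switchingForm, map_sum, Finset.mul_sum]
    refine Finset.sum_congr rfl fun i _ => ?_
    simp [Units.smul_def]
    ring
  rw [hsum, mul_eq_zero, or_iff_right c.ne_zero]
  obtain ⟨i, j, hij, h1, h2'⟩ := hA e
  have hfr : (e : Sym2 V) ∉ G.frustratedEdges b ↔ G.sign e = b i * b j := by
    have hmul : ((e : Sym2 V).map b).mul = b i * b j := by rw [hij, Sym2.map_mk, Sym2.mul_mk]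
    simp only [frustratedEdges, Set.mem_ofPred_eq, e.2, true_and, not_not,
      G.extendedSign_of_mem e.2, hmul]
  rw [hfr]
  rcases Int.units_eq_one_or (G.sign e) with h | h
  · rw [h1 h, h]
    simp only [Pi.sub_apply, mul_sub, Finset.sum_sub_distrib, Pi.single_apply, mul_ite, mul_one,
      mul_zero, Finset.sum_ite_eq', Finset.mem_univ, if_true]
    rcases Int.units_eq_one_or (b i) with hi | hi <;>
    rcases Int.units_eq_one_or (b j) with hj | hj <;> simp [hi, hj] <;> ring_nf <;> simp [h2]
  · rw [h2' h, h]
    simp only [Pi.add_apply, mul_add, Finset.sum_add_distrib, Pi.single_apply, mul_ite, mul_one,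
      mul_zero, Finset.sum_ite_eq', Finset.mem_univ, if_true]
    rcases Int.units_eq_one_or (b i) with hi | hi <;>
    rcases Int.units_eq_one_or (b j) with hj | hj <;> simp [hi, hj] <;> ring_nf <;> simp [h2]

theorem IsIncidenceMatrix.zeros_switchingForm (hA : G.IsIncidenceMatrix A)
    (hK : ringChar K ≠ 2) (b : V → ℤˣ) :
    {P ∈ columnPoints A | MvPolynomial.eval P.rep (switchingForm K b) = 0} =
      hA.point '' {e | (e : Sym2 V) ∉ G.frustratedEdges b} := by
  ext P
  rw [← hA.range_point]
  constructor
  · rintro ⟨⟨e, rfl⟩, he⟩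
    exact ⟨e, (hA.eval_switchingForm_eq_zero_iff hK b e).mp he, rfl⟩
  · rintro ⟨e, he, rfl⟩
    exact ⟨⟨e, rfl⟩, (hA.eval_switchingForm_eq_zero_iff hK b e).mpr he⟩

theorem IsIncidenceMatrix.ncard_zeros_add_ncard_frustratedEdges (hA : G.IsIncidenceMatrix A)
    (hK : ringChar K ≠ 2) (b : V → ℤˣ) :
    {P ∈ columnPoints A | MvPolynomial.eval P.rep (switchingForm K b) = 0}.ncard +
      (G.frustratedEdges b).ncard = (columnPoints A).ncard := by
  have hfr : (G.frustratedEdges b).ncard =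
      {e : G.graph.edgeSet | (e : Sym2 V) ∈ G.frustratedEdges b}.ncard := by
    rw [← Set.ncard_image_of_injective _ Subtype.val_injective]
    congr 1
    ext e
    constructor
    · exact fun he => ⟨⟨e, he.1⟩, he, rfl⟩
    · rintro ⟨e, he, rfl⟩
      exact he
  have hX : (columnPoints A).ncard = Nat.card G.graph.edgeSet := by
    rw [← hA.range_point, ← Set.image_univ, Set.ncard_image_of_injective _ hA.point_injective,
      Set.ncard_univ]
  rw [hA.zeros_switchingForm hK, Set.ncard_image_of_injective _ hA.point_injective, hfr, hX,
    add_comm]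
  exact Set.ncard_add_ncard_compl _

end Columns

/-- Putting the sign of the edge on one endpoint and `1` elsewhere satisfies it. Hence the minimum
number of violations is below the number of edges. -/
theorem exists_notMem_frustratedEdges {V : Type*} (G : SignedSimpleGraph V)
    {e : Sym2 V} (he : e ∈ G.graph.edgeSet) : ∃ b : V → ℤˣ, e ∉ G.frustratedEdges b := by
  classical
  induction e with
  | _ i j =>
  have hne : i ≠ j := G.graph.ne_of_adj he
  refine ⟨Pi.mulSingle i (G.extendedSign s(i, j)), fun h => h.2 ?_⟩
  simp [Pi.mulSingle_eq_of_ne hne.symm]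

end SignedSimpleGraph

/-! ### Conclusion: degrees against frustrated edges -/

theorem mem_signForms_iff {V K : Type*} [Fintype V] [Field K] {I : Ideal (MvPolynomial V K)}
    {h : MvPolynomial V K} :
    h ∈ signForms I ↔
      (∃ b : V → ℤˣ, h = SignedSimpleGraph.switchingForm K b) ∧ I.colon {h} ≠ I := by
  refine and_congr_left fun _ => ⟨?_, ?_⟩
  · rintro ⟨a, ha, rfl⟩
    have hb : ∀ i, ∃ u : ℤˣ, ((u : ℤ) : K) = a i := fun i => by
      rcases ha i with hi | hi
      · exact ⟨1, by simp [hi]⟩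
      · exact ⟨-1, by simp [hi]⟩
    choose b hb using hb
    exact ⟨b, by simp only [SignedSimpleGraph.switchingForm, hb]⟩
  · rintro ⟨b, rfl⟩
    refine ⟨fun i => ((b i : ℤ) : K), fun i => ?_, rfl⟩
    rcases Int.units_eq_one_or (b i) with hi | hi <;> simp [hi]

theorem mainTheorem5 {V : Type*} [Fintype V] [DecidableEq V] (G : SignedSimpleGraph V)
    (hconn : G.graph.Connected) (hunb : ¬ G.IsBalanced)
    (K : Type*) [Field K] (hK : ringChar K ≠ 2)
    (A : Matrix V G.graph.edgeSet K) (hA : G.IsIncidenceMatrix A)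
    (X : Set (ℙ K (V → K))) (hX : X = columnPoints A)
    (I : Ideal (MvPolynomial V K)) (hI : I = projVanishingIdeal X) :
    (∀ h ∈ signForms I, ∃! n : ℕ, HasDegree (I ⊔ Ideal.span {h}) n) ∧
    ∃ M : ℕ, IsGreatest {n : ℕ | ∃ h ∈ signForms I, HasDegree (I ⊔ Ideal.span {h}) n} M ∧
      (G.frustrationIndex : ℤ) = (X.ncard : ℤ) - (M : ℤ) := by
  subst hI hX
  have hfin : (columnPoints A).Finite := by
    rw [← hA.range_point]
    exact Set.finite_range _
  have hdeg : ∀ b : V → ℤˣ,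
      SignedSimpleGraph.switchingForm K b ∈ signForms (projVanishingIdeal (columnPoints A)) →
      ∀ n, HasDegree (projVanishingIdeal (columnPoints A) ⊔
        Ideal.span {SignedSimpleGraph.switchingForm K b}) n ↔
        n + (G.frustratedEdges b).ncard = (columnPoints A).ncard := by
    intro b hb n
    have hhom := SignedSimpleGraph.switchingForm_isHomogeneous (K := K) b
    rw [hasDegree_sup_span_iff hfin hhom ((colon_ne_iff hfin hhom).mp hb.2),
      ← hA.ncard_zeros_add_ncard_frustratedEdges hK b, Nat.add_right_cancel_iff]
  -- Without edges there are no cycles, and the graph would be balanced.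
  obtain ⟨e, he⟩ : G.graph.edgeSet.Nonempty := by
    by_contra hempty
    refine hunb fun v p hp => absurd ?_ hp.not_nil
    cases p with
    | nil => exact SimpleGraph.Walk.nil_nil
    | cons h p => exact absurd ⟨_, (SimpleGraph.mem_edgeSet _).mpr h⟩ hempty
  obtain ⟨a, ha⟩ := G.exists_ncard_frustratedEdges_eq
  -- The optimal `a` leaves some edge unfrustrated, so its form has a zero in `X` and meets the
  -- colon condition.
  have hzero : {P ∈ columnPoints A |
      MvPolynomial.eval P.rep (SignedSimpleGraph.switchingForm K a) = 0}.Nonempty := by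
    obtain ⟨b, hb⟩ := G.exists_notMem_frustratedEdges he
    have hlt : (G.frustratedEdges a).ncard < G.graph.edgeSet.ncard := by
      refine ha.trans_lt ((G.frustrationIndex_le b).trans_lt ?_)
      exact Set.ncard_lt_ncard ⟨fun x hx => hx.1, fun h => hb (h he)⟩ (Set.toFinite _)
    obtain ⟨x, hx, hxa⟩ := Set.exists_mem_notMem_of_ncard_lt_ncard hlt (Set.toFinite _)
    rw [hA.zeros_switchingForm hK]
    exact ⟨_, ⟨x, hx⟩, hxa, rfl⟩
  have hamem : SignedSimpleGraph.switchingForm K a ∈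
      signForms (projVanishingIdeal (columnPoints A)) :=
    mem_signForms_iff.mpr ⟨⟨a, rfl⟩,
      (colon_ne_iff hfin (SignedSimpleGraph.switchingForm_isHomogeneous a)).mpr hzero⟩
  have hle : (G.frustratedEdges a).ncard ≤ (columnPoints A).ncard := by
    rw [← hA.ncard_zeros_add_ncard_frustratedEdges hK a]
    exact Nat.le_add_left _ _
  refine ⟨fun h hh => ?_, (columnPoints A).ncard - (G.frustratedEdges a).ncard, ⟨?_, ?_⟩, ?_⟩
  · obtain ⟨⟨b, rfl⟩, -⟩ := mem_signForms_iff.mp hh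
    refine ⟨_, (hdeg b hh _).mpr (hA.ncard_zeros_add_ncard_frustratedEdges hK b), fun n hn => ?_⟩
    have h1 := (hdeg b hh n).mp hn
    have h2 := hA.ncard_zeros_add_ncard_frustratedEdges hK b
    omega
  · exact ⟨_, hamem, (hdeg a hamem _).mpr (Nat.sub_add_cancel hle)⟩
  · rintro n ⟨h, hh, hn⟩
    obtain ⟨⟨b, rfl⟩, -⟩ := mem_signForms_iff.mp hh
    have h1 := (hdeg b hh n).mp hn
    have h2 := G.frustrationIndex_le b
    omega
  · rw [← ha, Nat.cast_sub hle]
    ring
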